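/- Conventions. For an integer $k \neq 0$ let $\mathrm{bl}(k) = \max\{1, \lceil \log_2 |k| \rceil\}$, and let $\mathrm{bl}(0)=1$. For a rational $r = p/q$ in lowest terms, $q \ge 1$, let $\mathrm{bl}(r) = \mathrm{bl}(p) + \mathrm{bl}(q)$. The bit length of a rational vector or matrix is the sum of the bit lengths of its entries. For a polynomial $f = \sum_\alpha f_\alpha x^\alpha \in \mathbb{Q}[x_1,\dots,x_n]$ put $\langle f \rangle = n + \deg(f) + \sum_{\alpha : f_\alpha \neq 0} \mathrm{bl}(f_\alpha)$ (with $\deg 0 = 0$). For a polyhedron $P = \{x \in \mathbb{R}^n : Ax \le b\}$ given by $A \in \mathbb{Q}^{m \times n}$ and $b \in \mathbb{Q}^m$ put $\langle P \rangle = \mathrm{bl}(A) + \mathrm{bl}(b)$. $\|\cdot\|$ is the Euclidean norm. Theorem 1.1. There is a polynomial $p$ in two variables with nonnegative integer coefficients such that the following holds for all integers $n, m \ge 0$, all polynomials $f \in \mathbb{Q}[x_1,\dots,x_n]$ that are convex as functions on $\mathbb{R}^n$, and all $A \in \mathbb{Q}^{m\times n}$, $b \in \mathbb{Q}^m$ for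 which $P = \{x \in \mathbb{R}^n : Ax \le b\}$ is nonempty. Either $f$ is unbounded from below on $P$, or $f$ attains its minimum on $P$ at a point $x^* \in P$ with $$\log \|x^*\| \le p(\langle f \rangle, \langle P \rangle),$$ where the inequality counts as satisfied if $x^* = 0$. -/

import Mathlib

namespace ConvexPolyProg

/-- Bit length of an integer: `max {1, ⌈log₂ |k|⌉}` (and `1` for `k = 0`). -/
def intBitLength (k : ℤ) : ℕ := max 1 (Nat.clog 2 k.natAbs)

/-- Bit length of a rational: the bit lengths of the numerator and the denominator of its
reduced fraction, added. -/
def ratBitLength (r : ℚ) : ℕ := intBitLength r.num + intBitLength (r.den : ℤ)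

/-- Bit length of a rational vector: the sum over its entries. -/
def vecBitLength {m : ℕ} (b : Fin m → ℚ) : ℕ := ∑ i, ratBitLength (b i)

/-- Bit length of a rational matrix: the sum over its entries. -/
def matBitLength {m n : ℕ} (A : Matrix (Fin m) (Fin n) ℚ) : ℕ :=
  ∑ i, ∑ j, ratBitLength (A i j)

/-- Encoding length of a rational polynomial in `n` variables (binary coefficients, unary
exponents): `n + deg f + ∑_{α : f_α ≠ 0} bl(f_α)`. -/
noncomputable def polynomialEncLength {n : ℕ} (f : MvPolynomial (Fin n) ℚ) : ℕ :=
  n + f.totalDegree + ∑ α ∈ f.support, ratBitLength (f.coeff α)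

/-- Encoding length of the polyhedron `{x | A x ≤ b}`: `bl(A) + bl(b)`. -/
def polyhedronEncLength {m n : ℕ} (A : Matrix (Fin m) (Fin n) ℚ) (b : Fin m → ℚ) : ℕ :=
  matBitLength A + vecBitLength b

/-- The polyhedron `{x ∈ ℝⁿ | A x ≤ b}`. -/
def polyhedron {m n : ℕ} (A : Matrix (Fin m) (Fin n) ℚ) (b : Fin m → ℚ) :
    Set (EuclideanSpace ℝ (Fin n)) :=
  {x | ∀ i, ∑ j, (A i j : ℝ) * x j ≤ (b i : ℝ)}

/-- The real function on `ℝⁿ` defined by a rational polynomial. -/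
noncomputable def realFun {n : ℕ} (f : MvPolynomial (Fin n) ℚ) (x : EuclideanSpace ℝ (Fin n)) :
    ℝ :=
  MvPolynomial.aeval (fun i => x i) f

end ConvexPolyProg

/-! Clear denominators, so that f, A and b are integral. Let M be the sum of the Hessians of f over
the grid {0, …, deg f}^n. The Hessians are positive semidefinite with polynomial entries of degree
at most deg f, so ker M is the common kernel of all of them (`hess_mulVec_eq_zero_of_gridHess`) and
f is affine along ker M (`eval_add_of_hess_mulVec_eq_zero`).

The key estimate is that xᵀMx grows only linearly in ‖x‖ as long as f(x) stays below a fixed bound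
(`dotProduct_gridHess_le`). Convexity bounds f by O(‖x‖) from both sides at points u + θx with u in
the grid and θ ≤ 1/2, and interpolation carries this over to the second-order coefficient. By
Cauchy–Schwarz, Mx has size O(√‖x‖), and Cramer's rule gives s = O(√‖x‖) with Ms = Mx.

On s + ker M, which contains x, f is affine. The problem there is a linear program with right-hand
side O(√‖x‖), so it has a feasible point z with f(z) ≤ f(x) and ‖z‖² ≤ C‖x‖ (`exists_sq_norm_le`).
Hence points of least norm in the relevant sublevel sets have norm at most C, and the minimum over
the ball of radius C is the minimum over P. Every constant has the form 2 ^ L ^ k with k absolute,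
so the estimates only keep track of k. -/

namespace ConvexPolyProg
open Matrix

/-! ### Bounds of the form `2 ^ L ^ k` -/

/-- The bound `2 ^ L ^ k`; for fixed `k` its logarithm is polynomial in `L`. -/
noncomputable def expBound (L k : ℕ) : ℝ := 2 ^ L ^ k

theorem expBound_pos (L k : ℕ) : 0 < expBound L k := by unfold expBound; positivity

theorem one_le_expBound (L k : ℕ) : 1 ≤ expBound L k := one_le_pow₀ (by norm_num)

theorem expBound_mono {L a b : ℕ} (hL : 2 ≤ L) (h : a ≤ b) : expBound L a ≤ expBound L b :=
  pow_le_pow_right₀ (by norm_num) (Nat.pow_le_pow_right (by omega) h)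

theorem two_le_expBound {L : ℕ} (hL : 2 ≤ L) (k : ℕ) : 2 ≤ expBound L k := by
  calc (2 : ℝ) = expBound L 0 := by simp [expBound]
    _ ≤ _ := expBound_mono hL (Nat.zero_le k)

/-- L ^ a + L ^ b ≤ 2 * L ^ (c - 1) ≤ L ^ c, so a product of two bounds costs one level. -/
theorem expBound_mul_le {L a b c : ℕ} (hL : 2 ≤ L) (ha : a < c) (hb : b < c) :
    expBound L a * expBound L b ≤ expBound L c := by
  obtain ⟨d, rfl⟩ : ∃ d, c = d + 1 := ⟨c - 1, by omega⟩
  unfold expBound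
  rw [← pow_add]
  refine pow_le_pow_right₀ (by norm_num) ?_
  have h1 : L ^ a ≤ L ^ d := Nat.pow_le_pow_right (by omega) (by omega)
  have h2 : L ^ b ≤ L ^ d := Nat.pow_le_pow_right (by omega) (by omega)
  rw [pow_succ]
  nlinarith [Nat.mul_le_mul_left (L ^ d) hL]

theorem expBound_mul_mono {L a b c : ℕ} {x y : ℝ} (hL : 2 ≤ L) (ha : a < c) (hb : b < c)
    (hx : x ≤ expBound L a) (hy : y ≤ expBound L b) (hy0 : 0 ≤ y) : x * y ≤ expBound L c :=
  (mul_le_mul hx hy hy0 (expBound_pos _ _).le).trans (expBound_mul_le hL ha hb)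

theorem expBound_add_mono {L a b c : ℕ} {x y : ℝ} (hL : 2 ≤ L) (ha : a < c) (hb : b < c)
    (hx : x ≤ expBound L a) (hy : y ≤ expBound L b) : x + y ≤ expBound L c := by
  have := expBound_mul_le hL ha hb
  -- Both bounds are at least 2, so their sum is at most their product.
  nlinarith [two_le_expBound hL a, two_le_expBound hL b]

theorem expBound_pow_le {L a j : ℕ} (hj : j ≤ L) : expBound L a ^ j ≤ expBound L (a + 1) := by
  unfold expBound
  rw [← pow_mul]
  refine pow_le_pow_right₀ (by norm_num) ?_
  rw [pow_succ]
  exact Nat.mul_le_mul_left _ hj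

theorem natCast_le_expBound {L j : ℕ} (hj : j ≤ L) : (j : ℝ) ≤ expBound L 1 := by
  unfold expBound
  have : j ≤ 2 ^ L ^ 1 := by rw [pow_one]; exact hj.trans Nat.lt_two_pow_self.le
  exact_mod_cast this

theorem natCast_pow_le_expBound {L j k : ℕ} (hj : j ≤ L) (hk : k ≤ L) :
    (j : ℝ) ^ k ≤ expBound L 2 :=
  (pow_le_pow_left₀ (by positivity) (natCast_le_expBound hj) k).trans (expBound_pow_le hk)

theorem factorial_le_expBound {L j : ℕ} (hj : j ≤ L) : (j.factorial : ℝ) ≤ expBound L 2 := by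
  refine le_trans ?_ (natCast_pow_le_expBound hj hj)
  exact_mod_cast Nat.factorial_le_pow j

theorem abs_sum_le_card_mul {ι : Type*} [Fintype ι] (g : ι → ℝ) {c : ℝ} (h : ∀ i, |g i| ≤ c) :
    |∑ i, g i| ≤ Fintype.card ι * c := by
  refine (Finset.abs_sum_le_sum_abs _ _).trans ?_
  simpa using Finset.sum_le_card_nsmul Finset.univ (fun i => |g i|) c (fun i _ => h i)

/-! ### Small solutions of linear systems with integer coefficients -/

/-- The real matrix of an integer matrix. -/
abbrev toReal {ι κ : Type*} (N : Matrix ι κ ℤ) : Matrix ι κ ℝ := N.map (Int.cast : ℤ → ℝ)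

/-- Cramer's rule for the normal equations: G = NᵀN is an invertible integer matrix, so |det G| ≥ 1,
and det G · x = adj G · Nᵀ(Nx). The right-hand side Nx may be real; it enters linearly. -/
theorem abs_le_of_injective_mulVec {ι κ : Type*} [Fintype ι] [Fintype κ] [DecidableEq κ]
    (N : Matrix ι κ ℤ) {L a : ℕ} (hL : 2 ≤ L) (ha : 1 ≤ a) (hι : Fintype.card ι ≤ L)
    (hκ : Fintype.card κ ≤ L) (hN : ∀ i j, |(N i j : ℝ)| ≤ expBound L a)
    (hinj : Function.Injective (toReal N).mulVec) (x : κ → ℝ) {c : ℝ}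
    (hc : ∀ i, |(toReal N *ᵥ x) i| ≤ c) (hc0 : 0 ≤ c) (j : κ) :
    |x j| ≤ expBound L (a + 5) * c := by
  set G : Matrix κ κ ℤ := Nᵀ * N with hG
  have hGR : toReal G = (toReal N)ᵀ * toReal N := by
    ext i j; simp [hG, Matrix.mul_apply]
  have hdet : (toReal G).det ≠ 0 := by
    intro h
    -- If Gv = 0 then Nv · Nv = v · Gv = 0, hence Nv = 0.
    obtain ⟨v, hv, hv'⟩ := Matrix.exists_mulVec_eq_zero_iff.2 h
    apply hv
    apply hinj
    rw [Matrix.mulVec_zero, ← dotProduct_self_eq_zero, Matrix.dotProduct_mulVec,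
      ← Matrix.mulVec_transpose, Matrix.mulVec_mulVec, ← hGR, hv', zero_dotProduct]
  have hdetG : (toReal G).det = (G.det : ℝ) := by
    simpa [RingHom.mapMatrix_apply] using (RingHom.map_det (Int.castRingHom ℝ) G).symm
  have hdet1 : 1 ≤ |(toReal G).det| := by
    rw [hdetG] at hdet ⊢
    have : G.det ≠ 0 := by exact_mod_cast hdet
    exact_mod_cast Int.one_le_abs this
  have hGb : ∀ i j, |toReal G i j| ≤ expBound L (a + 2) := by
    intro i j
    rw [hGR, Matrix.mul_apply]
    refine (abs_sum_le_card_mul (c := expBound L (a + 1)) _ fun k => ?_).trans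
      (expBound_mul_mono hL (by omega) (by omega) (natCast_le_expBound hι) le_rfl
        (expBound_pos _ _).le)
    simp only [Matrix.transpose_apply, Matrix.map_apply, abs_mul]
    exact expBound_mul_mono hL (by omega) (by omega) (hN _ _) (hN _ _) (abs_nonneg _)
  have hadj : ∀ i j, |(toReal G).adjugate i j| ≤ expBound L (a + 4) := by
    intro i j
    rw [Matrix.adjugate_apply]
    have := Matrix.det_le (abv := AbsoluteValue.abs) (x := expBound L (a + 2))
      (A := (toReal G).updateRow j (Pi.single i 1)) (fun r s => by
        simp only [AbsoluteValue.abs_apply]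
        by_cases hr : r = j
        · subst hr
          rw [Matrix.updateRow_self]
          refine le_trans ?_ (one_le_expBound L (a + 2))
          by_cases hs : s = i
          · subst hs; simp
          · simp [hs]
        · rw [Matrix.updateRow_ne hr]; exact hGb _ _)
    refine this.trans ?_
    rw [nsmul_eq_mul]
    exact expBound_mul_mono hL (by omega) (by omega) (factorial_le_expBound hκ)
      (expBound_pow_le hκ) (by have := expBound_pos L (a + 2); positivity)
  have hr : ∀ l, |((toReal N)ᵀ *ᵥ (toReal N *ᵥ x)) l| ≤ expBound L (a + 1) * c := by
    intro l
    refine (abs_sum_le_card_mul (c := expBound L a * c) _ fun k => ?_).trans ?_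
    · simp only [Matrix.transpose_apply, Matrix.map_apply, abs_mul]
      exact mul_le_mul (hN _ _) (hc _) (abs_nonneg _) (expBound_pos _ _).le
    · rw [← mul_assoc]
      gcongr
      obtain ⟨b, rfl⟩ : ∃ b, a = b + 1 := ⟨a - 1, by omega⟩
      exact expBound_mul_mono hL (by omega) (by omega) (natCast_le_expBound hι) le_rfl
        (expBound_pos _ _).le
  have key : (toReal G).det * x j =
      ((toReal G).adjugate *ᵥ ((toReal N)ᵀ *ᵥ (toReal N *ᵥ x))) j := by
    rw [Matrix.mulVec_mulVec x, ← hGR, Matrix.mulVec_mulVec, Matrix.adjugate_mul,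
      Matrix.smul_mulVec, Matrix.one_mulVec, Pi.smul_apply, smul_eq_mul]
  calc |x j| ≤ |(toReal G).det| * |x j| := le_mul_of_one_le_left (abs_nonneg _) hdet1
    _ = |((toReal G).adjugate *ᵥ ((toReal N)ᵀ *ᵥ (toReal N *ᵥ x))) j| := by rw [← key, abs_mul]
    _ ≤ Fintype.card κ * (expBound L (a + 4) * (expBound L (a + 1) * c)) :=
        abs_sum_le_card_mul _ fun l => by
          rw [abs_mul]
          exact mul_le_mul (hadj _ _) (hr _) (abs_nonneg _) (expBound_pos _ _).le
    _ = expBound L (a + 4) * (Fintype.card κ * expBound L (a + 1)) * c := by ring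
    _ ≤ _ := by
        gcongr
        refine expBound_mul_mono (b := a + 2) hL (by omega) (by omega) le_rfl ?_
          (by have := expBound_pos L (a + 1); positivity)
        exact expBound_mul_mono hL (by omega) (by omega) (natCast_le_expBound hκ) le_rfl
          (expBound_pos _ _).le

/-- A solvable real linear system with integer coefficients has a solution whose size is bounded
in terms of the coefficients and linearly in the right-hand side. -/
theorem exists_mulVec_eq_abs_le {ι κ : Type*} [Fintype ι] [Fintype κ]
    (N : Matrix ι κ ℤ) {L a : ℕ} (hL : 2 ≤ L) (ha : 1 ≤ a) (hι : Fintype.card ι ≤ L)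
    (hκ : Fintype.card κ ≤ L) (hN : ∀ i j, |(N i j : ℝ)| ≤ expBound L a)
    (x : κ → ℝ) {c : ℝ} (hc : ∀ i, |(toReal N *ᵥ x) i| ≤ c) (hc0 : 0 ≤ c) :
    ∃ y, toReal N *ᵥ y = toReal N *ᵥ x ∧ ∀ j, |y j| ≤ expBound L (a + 5) * c := by
  classical
  -- Keep a set of columns forming a basis of the column space, solve there uniquely, and set the
  -- other variables to zero.
  obtain ⟨κ', e, he, hspan, hli⟩ := exists_linearIndependent' ℝ (toReal N).col
  have : Fintype κ' := Fintype.ofInjective e he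
  have hsub : (toReal (N.submatrix id e)).col = (toReal N).col ∘ e := by
    rfl
  have hmem : toReal N *ᵥ x ∈ Submodule.span ℝ (Set.range (toReal (N.submatrix id e)).col) := by
    rw [hsub, hspan, ← Matrix.range_mulVecLin]
    exact ⟨x, rfl⟩
  rw [← Matrix.range_mulVecLin] at hmem
  obtain ⟨z, hz⟩ := hmem
  rw [Matrix.mulVecLin_apply] at hz
  have hzb := abs_le_of_injective_mulVec (N.submatrix id e) hL ha hι
    ((Fintype.card_le_of_injective e he).trans hκ) (fun i j => hN _ _)
    (Matrix.mulVec_injective_iff.2 (hsub ▸ hli)) z (c := c) (by rw [hz]; exact hc) hc0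
  refine ⟨Function.extend e z 0, ?_, fun j => ?_⟩
  · rw [← hz]
    ext i
    refine (Fintype.sum_of_injective e he _ _ (fun j hj => ?_) fun j => ?_).symm
    · rw [Function.extend_apply' _ _ _ (by simpa using hj)]; simp
    · rw [he.extend_apply]; simp
  · by_cases hj : ∃ k, e k = j
    · obtain ⟨k, rfl⟩ := hj
      rw [he.extend_apply]; exact hzb k
    · rw [Function.extend_apply' _ _ _ hj]
      simpa using mul_nonneg (expBound_pos L (a + 5)).le hc0

/-! ### Linear programs with integer coefficients and real right-hand side -/

/-- A feasible point whose set of tight constraints is maximal among the feasible points with at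
most a given objective value. -/
theorem exists_maximal_tight {ι E : Type*} [Finite ι] [AddCommGroup E] [Module ℝ E]
    (V : Submodule ℝ E) (α : ι → E →ₗ[ℝ] ℝ) (ℓ : E →ₗ[ℝ] ℝ) (c : ι → ℝ) (v : E) (hv : v ∈ V)
    (hvc : ∀ i, α i v ≤ c i) (hbdd : BddBelow (ℓ '' {w | w ∈ V ∧ ∀ i, α i w ≤ c i})) :
    ∃ w ∈ V, (∀ i, α i w ≤ c i) ∧ ℓ w ≤ ℓ v ∧
      ∀ d ∈ V, (∀ i, α i w = c i → α i d = 0) → (∀ i, α i d = 0) ∧ ℓ d = 0 := by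
  classical
  have := Fintype.ofFinite ι
  let T : Set (Finset ι) := {t | ∃ w ∈ V, (∀ i, α i w ≤ c i) ∧ ℓ w ≤ ℓ v ∧
    Finset.univ.filter (fun i => α i w = c i) = t}
  obtain ⟨t, ⟨w, hwV, hwc, hwl, hwt⟩, hmax⟩ :=
    (Set.toFinite T).exists_maximal ⟨_, v, hv, hvc, le_rfl, rfl⟩
  -- Otherwise, moving along d until the first constraint blocks keeps the objective from rising and
  -- adds a tight constraint, against maximality.
  have hneg : ∀ d ∈ V, (∀ i, α i w = c i → α i d = 0) → ℓ d ≤ 0 → ∀ i, α i d ≤ 0 := by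
    intro d hdV hd hld
    by_contra! hpos
    obtain ⟨i₁, hi₁⟩ := hpos
    obtain ⟨i₀, hi₀, hmin⟩ := Finset.exists_min_image
      (Finset.univ.filter fun i => 0 < α i d) (fun i => (c i - α i w) / α i d)
      ⟨i₁, by simpa using hi₁⟩
    simp only [Finset.mem_filter, Finset.mem_univ, true_and] at hi₀ hmin
    set τ := (c i₀ - α i₀ w) / α i₀ d with hτ
    have hτ0 : 0 ≤ τ := div_nonneg (sub_nonneg.2 (hwc _)) hi₀.le
    have hmem : Finset.univ.filter (fun i => α i (w + τ • d) = c i) ∈ T := by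
      refine ⟨w + τ • d, V.add_mem hwV (V.smul_mem _ hdV), fun i => ?_, ?_, rfl⟩
      · rw [map_add, map_smul, smul_eq_mul]
        by_cases hi : 0 < α i d
        · have := hmin i hi
          rw [le_div_iff₀ hi] at this
          linarith
        · nlinarith [hwc i]
      · rw [map_add, map_smul, smul_eq_mul]
        nlinarith
    have hle : t ≤ Finset.univ.filter (fun i => α i (w + τ • d) = c i) := by
      intro i hi
      rw [← hwt] at hi
      simp only [Finset.mem_filter, Finset.mem_univ, true_and] at hi ⊢
      rw [map_add, map_smul, hd i hi, hi, smul_zero, add_zero]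
    have h₀ : i₀ ∈ t := by
      apply hmax hmem hle
      simp only [Finset.mem_filter, Finset.mem_univ, true_and]
      rw [map_add, map_smul, smul_eq_mul, hτ, div_mul_cancel₀ _ hi₀.ne']
      ring
    rw [← hwt] at h₀
    simp only [Finset.mem_filter, Finset.mem_univ, true_and] at h₀
    exact hi₀.ne' (hd i₀ h₀)
  -- If ℓ d < 0, then by `hneg` the whole ray from w along d is feasible, and the chosen step length
  -- pushes ℓ below its lower bound K.
  have hnn : ∀ d ∈ V, (∀ i, α i w = c i → α i d = 0) → 0 ≤ ℓ d := by
    intro d hdV hd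
    by_contra! hlt
    obtain ⟨K, hK⟩ := hbdd
    have hs : 0 ≤ (|K - ℓ w| + 1) / (-ℓ d) := by
      have : 0 < -ℓ d := by linarith
      positivity
    have := hK ⟨w + ((|K - ℓ w| + 1) / (-ℓ d)) • d,
      ⟨V.add_mem hwV (V.smul_mem _ hdV), fun i => by
        rw [map_add, map_smul, smul_eq_mul]
        nlinarith [hwc i, hneg d hdV hd hlt.le i]⟩, rfl⟩
    rw [map_add, map_smul, smul_eq_mul, div_mul_eq_mul_div, div_neg,
      mul_div_cancel_right₀ _ hlt.ne] at this
    linarith [neg_abs_le (K - ℓ w)]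
  refine ⟨w, hwV, hwc, hwl, fun d hdV hd => ?_⟩
  have hd' : ∀ i, α i w = c i → α i (-d) = 0 := fun i hi => by rw [map_neg, hd i hi, neg_zero]
  have h1 := hnn d hdV hd
  have h2 := hnn (-d) (V.neg_mem hdV) hd'
  rw [map_neg] at h2
  have h3 : ℓ d = 0 := by linarith
  refine ⟨fun i => le_antisymm (hneg d hdV hd h3.le i) ?_, h3⟩
  have := hneg (-d) (V.neg_mem hdV) hd' (by rw [map_neg, h3, neg_zero]) i
  rw [map_neg] at this
  linarith

/-- If a linear functional is bounded below on `{w | B w = 0, A w ≤ c}`, then each feasible value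
is undercut by a feasible point whose size is bounded linearly in `c`. -/
theorem exists_feasible_abs_le {m k n : ℕ} (A : Matrix (Fin m) (Fin n) ℤ)
    (B : Matrix (Fin k) (Fin n) ℤ) {L a : ℕ} (hL : 2 ≤ L) (ha : 1 ≤ a) (hmk : m + k ≤ L)
    (hn : n ≤ L) (hA : ∀ i j, |(A i j : ℝ)| ≤ expBound L a)
    (hB : ∀ i j, |(B i j : ℝ)| ≤ expBound L a) (ℓ : (Fin n → ℝ) →ₗ[ℝ] ℝ) (c : Fin m → ℝ)
    (v : Fin n → ℝ) (hvB : toReal B *ᵥ v = 0) (hvA : ∀ i, (toReal A *ᵥ v) i ≤ c i)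
    (hbdd : BddBelow (ℓ '' {w | toReal B *ᵥ w = 0 ∧ ∀ i, (toReal A *ᵥ w) i ≤ c i}))
    {C : ℝ} (hC0 : 0 ≤ C) (hC : ∀ i, |c i| ≤ C) :
    ∃ w, toReal B *ᵥ w = 0 ∧ (∀ i, (toReal A *ᵥ w) i ≤ c i) ∧ ℓ w ≤ ℓ v ∧
      ∀ j, |w j| ≤ expBound L (a + 5) * C := by
  classical
  obtain ⟨w, hwV, hwc, hwl, hw⟩ := exists_maximal_tight
    (LinearMap.ker (toReal B).mulVecLin)
    (fun i => LinearMap.proj i ∘ₗ (toReal A).mulVecLin) ℓ c v (by simpa using hvB)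
    (by simpa using hvA) (by simpa using hbdd)
  simp only [LinearMap.mem_ker, Matrix.mulVecLin_apply, LinearMap.comp_apply,
    LinearMap.proj_apply] at hwV hwc hw
  let I := {i // (toReal A *ᵥ w) i = c i}
  -- The equations together with the constraints tight at w. A small y with Ny = Nw differs from w
  -- by a direction that keeps these tight, so by the choice of w all constraint values and the
  -- objective agree at y and w.
  let N : Matrix (Fin k ⊕ I) (Fin n) ℤ := Matrix.fromRows B (A.submatrix Subtype.val id)
  have hNl : ∀ (x : Fin n → ℝ) i, (toReal N *ᵥ x) (Sum.inl i) = (toReal B *ᵥ x) i :=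
    fun _ _ => rfl
  have hNr : ∀ (x : Fin n → ℝ) (i : I), (toReal N *ᵥ x) (Sum.inr i) = (toReal A *ᵥ x) i :=
    fun _ _ => rfl
  have hcard : Fintype.card (Fin k ⊕ I) ≤ L := by
    have : Fintype.card I ≤ m := by simpa using Fintype.card_subtype_le (α := Fin m) _
    simp only [Fintype.card_sum, Fintype.card_fin]
    omega
  obtain ⟨y, hy, hyb⟩ := exists_mulVec_eq_abs_le N hL ha hcard (by simpa using hn)
    (by rintro (i | i) j; exacts [hB i j, hA i j]) w (c := C)
    (by
      rintro (i | i)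
      · rw [hNl, hwV]; simpa using hC0
      · rw [hNr, i.2]; exact hC i) hC0
  have hyB : toReal B *ᵥ y = 0 := by
    ext i; rw [← hNl, hy, hNl, hwV]
  have hd := hw (y - w) (by rw [Matrix.mulVec_sub, hyB, hwV, sub_zero]) (fun i hi => by
    rw [Matrix.mulVec_sub, Pi.sub_apply, ← hNr y ⟨i, hi⟩, hy, hNr, sub_self])
  refine ⟨y, hyB, fun i => ?_, ?_, hyb⟩
  · have := hd.1 i
    rw [Matrix.mulVec_sub, Pi.sub_apply] at this
    linarith [hwc i]
  · have := hd.2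
    rw [map_sub] at this
    linarith

/-! ### Hessians and restrictions to lines of multivariate polynomials -/

section Hessian
variable {n : ℕ}

/-- The commutator of two derivations is a derivation, so it is enough that it kills the variables.
-/
theorem pderiv_comm {R : Type*} [CommRing R] {σ : Type*} (i j : σ) (f : MvPolynomial σ R) :
    MvPolynomial.pderiv i (MvPolynomial.pderiv j f) =
      MvPolynomial.pderiv j (MvPolynomial.pderiv i f) := by
  classical
  have h : ⁅MvPolynomial.pderiv (R := R) i, MvPolynomial.pderiv (R := R) j⁆ = 0 := by
    refine MvPolynomial.derivation_ext fun k => ?_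
    rw [Derivation.commutator_apply, MvPolynomial.pderiv_X, MvPolynomial.pderiv_X]
    by_cases hi : k = i <;> by_cases hj : k = j <;> simp [Pi.single_apply, hi, hj] <;>
      split_ifs <;> simp
  have := congrArg (fun D => D f) h
  simpa [Derivation.commutator_apply, sub_eq_zero] using this

/-- The Hessian matrix of a polynomial at a point. -/
noncomputable def hess {R : Type*} [CommRing R] (f : MvPolynomial (Fin n) R) (x : Fin n → R) :
    Matrix (Fin n) (Fin n) R :=
  Matrix.of fun i j => MvPolynomial.eval x (MvPolynomial.pderiv j (MvPolynomial.pderiv i f))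

theorem hess_apply {R : Type*} [CommRing R] (f : MvPolynomial (Fin n) R) (x : Fin n → R)
    (i j : Fin n) :
    hess f x i j = MvPolynomial.eval x (MvPolynomial.pderiv j (MvPolynomial.pderiv i f)) := rfl

theorem hess_transpose {R : Type*} [CommRing R] (f : MvPolynomial (Fin n) R) (x : Fin n → R) :
    (hess f x)ᵀ = hess f x := by
  ext i j
  rw [Matrix.transpose_apply, hess_apply, hess_apply, pderiv_comm]

/-- The univariate polynomial `t ↦ f (x + t v)`. -/
noncomputable def lineRestr (f : MvPolynomial (Fin n) ℝ) (x v : Fin n → ℝ) : Polynomial ℝ :=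
  MvPolynomial.aeval (fun i => Polynomial.C (v i) * Polynomial.X + Polynomial.C (x i)) f

theorem eval_lineRestr (f : MvPolynomial (Fin n) ℝ) (x v : Fin n → ℝ) (t : ℝ) :
    (lineRestr f x v).eval t = MvPolynomial.eval (x + t • v) f := by
  unfold lineRestr
  induction f using MvPolynomial.induction_on with
  | C a => simp
  | add p q hp hq => simp [hp, hq]
  | mul_X p i hp => simp [hp]; left; ring

theorem natDegree_lineRestr_le (f : MvPolynomial (Fin n) ℝ) (x v : Fin n → ℝ) :
    (lineRestr f x v).natDegree ≤ f.totalDegree := by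
  simpa [lineRestr] using MvPolynomial.aeval_natDegree_le (n := 1) f le_rfl _ fun i =>
    Polynomial.natDegree_linear_le

theorem derivative_lineRestr (f : MvPolynomial (Fin n) ℝ) (x v : Fin n → ℝ) :
    Polynomial.derivative (lineRestr f x v) =
      ∑ i, Polynomial.C (v i) * lineRestr (MvPolynomial.pderiv i f) x v := by
  classical
  induction f using MvPolynomial.induction_on with
  | C a => simp [lineRestr]
  | add p q hp hq =>
    have h : lineRestr (p + q) x v = lineRestr p x v + lineRestr q x v := by simp [lineRestr]
    rw [h, Polynomial.derivative_add, hp, hq, ← Finset.sum_add_distrib]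
    refine Finset.sum_congr rfl fun i _ => ?_
    simp [lineRestr, mul_add]
  | mul_X p k hp =>
    have h : lineRestr (p * MvPolynomial.X k) x v =
        lineRestr p x v * (Polynomial.C (v k) * Polynomial.X + Polynomial.C (x k)) := by
      simp [lineRestr]
    rw [h, Polynomial.derivative_mul, hp]
    have h2 : ∀ i, Polynomial.C (v i) * lineRestr
        (MvPolynomial.pderiv i (p * MvPolynomial.X k)) x v =
        Polynomial.C (v i) * lineRestr (MvPolynomial.pderiv i p) x v *
          (Polynomial.C (v k) * Polynomial.X + Polynomial.C (x k)) +
        if i = k then lineRestr p x v * Polynomial.C (v k) else 0 := by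
      intro i
      rw [MvPolynomial.pderiv_mul, MvPolynomial.pderiv_X]
      by_cases hi : i = k
      · subst hi; simp [lineRestr]; ring
      · simp [lineRestr, hi]; ring
    simp only [h2, Finset.sum_add_distrib, Finset.sum_ite_eq', Finset.mem_univ, if_true,
      Finset.sum_mul]
    simp

theorem eval_derivative_lineRestr (f : MvPolynomial (Fin n) ℝ) (x v : Fin n → ℝ) (t : ℝ) :
    (Polynomial.derivative (lineRestr f x v)).eval t =
      ∑ i, v i * MvPolynomial.eval (x + t • v) (MvPolynomial.pderiv i f) := by
  rw [derivative_lineRestr, Polynomial.eval_finsetSum]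
  simp [eval_lineRestr]

theorem eval_derivative_derivative_lineRestr (f : MvPolynomial (Fin n) ℝ) (x v : Fin n → ℝ)
    (t : ℝ) :
    (Polynomial.derivative (Polynomial.derivative (lineRestr f x v))).eval t =
      v ⬝ᵥ (hess f (x + t • v) *ᵥ v) := by
  rw [derivative_lineRestr, Polynomial.derivative_sum, Polynomial.eval_finsetSum]
  simp only [dotProduct, mulVec, hess_apply]
  refine Finset.sum_congr rfl fun i _ => ?_
  rw [Polynomial.derivative_C_mul, Polynomial.eval_mul, Polynomial.eval_C,
    eval_derivative_lineRestr]
  congr 1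
  exact Finset.sum_congr rfl fun j _ => mul_comm _ _

theorem two_mul_coeff_two_lineRestr (f : MvPolynomial (Fin n) ℝ) (x v : Fin n → ℝ) :
    2 * (lineRestr f x v).coeff 2 = v ⬝ᵥ (hess f x *ᵥ v) := by
  have := eval_derivative_derivative_lineRestr f x v 0
  rw [zero_smul, add_zero] at this
  rw [← this, ← Polynomial.coeff_zero_eq_eval_zero, Polynomial.coeff_derivative,
    Polynomial.coeff_derivative]
  norm_num
  ring

theorem eval_derivative_derivative_nonneg (g : Polynomial ℝ)
    (hg : ConvexOn ℝ Set.univ fun t => g.eval t) (t : ℝ) :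
    0 ≤ (Polynomial.derivative (Polynomial.derivative g)).eval t := by
  have h := hg.monotoneOn_deriv fun x _ => g.differentiableAt
  rw [monotoneOn_univ] at h
  have hd : (deriv fun t => g.eval t) = fun t => (Polynomial.derivative g).eval t := by
    ext t; exact g.deriv
  rw [hd] at h
  have := h.deriv_nonneg (x := t)
  rwa [Polynomial.deriv] at this

theorem hess_nonneg (f : MvPolynomial (Fin n) ℝ)
    (hf : ConvexOn ℝ Set.univ fun x : Fin n → ℝ => MvPolynomial.eval x f) (x v : Fin n → ℝ) :
    0 ≤ v ⬝ᵥ (hess f x *ᵥ v) := by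
  rw [← two_mul_coeff_two_lineRestr]
  have h : ConvexOn ℝ Set.univ fun t => (lineRestr f x v).eval t := by
    simp only [eval_lineRestr]
    have := hf.comp_affineMap (AffineMap.lineMap x (x + v))
    simp only [Set.preimage_univ] at this
    have e : (fun t : ℝ => MvPolynomial.eval (x + t • v) f) =
        (fun y => MvPolynomial.eval y f) ∘ (AffineMap.lineMap x (x + v) : ℝ →ᵃ[ℝ] Fin n → ℝ) := by
      ext t
      simp [AffineMap.lineMap_apply, add_comm]
    rwa [e]
  have := eval_derivative_derivative_nonneg _ h 0
  rwa [eval_derivative_derivative_lineRestr, zero_smul, add_zero,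
    ← two_mul_coeff_two_lineRestr] at this

/-- A polynomial is affine along each direction in the kernel of all its Hessians. -/
theorem eval_add_of_hess_mulVec_eq_zero (f : MvPolynomial (Fin n) ℝ) (v : Fin n → ℝ)
    (hv : ∀ x, hess f x *ᵥ v = 0) (x : Fin n → ℝ) :
    MvPolynomial.eval (x + v) f =
      MvPolynomial.eval x f + ∑ i, v i * MvPolynomial.eval x (MvPolynomial.pderiv i f) := by
  set g := lineRestr f x v with hg
  -- The second derivative along the line vanishes identically, so the restriction is affine.
  have h2 : Polynomial.derivative (Polynomial.derivative g) = 0 := by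
    refine Polynomial.funext fun t => ?_
    rw [eval_derivative_derivative_lineRestr, hv, dotProduct_zero, Polynomial.eval_zero]
  set s := ∑ i, v i * MvPolynomial.eval x (MvPolynomial.pderiv i f) with hs
  have h1 : Polynomial.derivative g = Polynomial.C s := by
    have := Polynomial.eq_C_of_natDegree_eq_zero
      (Polynomial.derivative_eq_zero.1 h2)
    rw [Polynomial.coeff_zero_eq_eval_zero, eval_derivative_lineRestr, zero_smul,
      add_zero] at this
    exact this
  have h0 : Polynomial.derivative (g - Polynomial.C s * Polynomial.X) = 0 := by
    rw [Polynomial.derivative_sub, h1]; simp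
  have h3 := Polynomial.eq_C_of_natDegree_eq_zero
    (Polynomial.derivative_eq_zero.1 h0)
  have e0 := congrArg (Polynomial.eval 0) h3
  have e1 := congrArg (Polynomial.eval 1) h3
  simp only [Polynomial.eval_sub, Polynomial.eval_mul, Polynomial.eval_C, Polynomial.eval_X,
    hg, eval_lineRestr, zero_smul, one_smul, add_zero] at e0 e1
  linarith

/-- Cauchy–Schwarz for positive semidefinite matrices, against a standard basis vector. -/
theorem mulVec_sq_le (S : Matrix (Fin n) (Fin n) ℝ) (hS : Sᵀ = S)
    (hpos : ∀ v, 0 ≤ v ⬝ᵥ (S *ᵥ v)) (x : Fin n → ℝ) (i : Fin n) :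
    (S *ᵥ x) i ^ 2 ≤ S i i * (x ⬝ᵥ (S *ᵥ x)) := by
  -- The quadratic form at x + t eᵢ is a nonnegative quadratic in t.
  have h := discrim_le_zero (a := S i i) (b := 2 * (S *ᵥ x) i) (c := x ⬝ᵥ (S *ᵥ x)) fun t => by
    have := hpos (x + t • Pi.single i 1)
    have e1 : Pi.single i 1 ⬝ᵥ (S *ᵥ x) = (S *ᵥ x) i := by simp
    have e2 : x ⬝ᵥ (S *ᵥ Pi.single i 1) = (S *ᵥ x) i := by
      rw [Matrix.dotProduct_mulVec, ← Matrix.mulVec_transpose, hS, dotProduct_single, mul_one]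
    have e3 : Pi.single i (1 : ℝ) ⬝ᵥ (S *ᵥ Pi.single i 1) = S i i := by simp
    simp only [Matrix.mulVec_add, Matrix.mulVec_smul, add_dotProduct, dotProduct_add,
      smul_dotProduct, dotProduct_smul, smul_eq_mul, e1, e2, e3] at this
    linarith
  rw [discrim] at h
  linarith

theorem totalDegree_pderiv_le {R : Type*} [CommRing R] (f : MvPolynomial (Fin n) R) (i : Fin n) :
    (MvPolynomial.pderiv i f).totalDegree ≤ f.totalDegree := by
  rw [MvPolynomial.totalDegree]
  refine Finset.sup_le fun m hm => ?_
  have hc : (m + Finsupp.single i 1) ∈ f.support := by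
    rw [MvPolynomial.mem_support_iff, MvPolynomial.coeff_pderiv] at hm
    exact MvPolynomial.mem_support_iff.2 (left_ne_zero_of_mul hm)
  refine le_trans ?_ (MvPolynomial.le_totalDegree hc)
  rw [Finsupp.sum_add_index' (fun _ => rfl) (fun _ _ _ => rfl)]
  exact Nat.le_add_right _ _

/-! ### The sum of the Hessians over a grid and its kernel -/

/-- The points of the grid `{0, …, N} ^ n`. -/
def gridPoint {N : ℕ} (u : Fin n → Fin (N + 1)) : Fin n → ℤ := fun i => ((u i : ℕ) : ℤ)

/-- The sum of the Hessians of `f` over the grid `{0, …, deg f} ^ n`. -/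
noncomputable def gridHess (f : MvPolynomial (Fin n) ℤ) : Matrix (Fin n) (Fin n) ℤ :=
  ∑ u : Fin n → Fin (f.totalDegree + 1), hess f (gridPoint u)

/-- The real polynomial of an integer polynomial. -/
noncomputable abbrev realPoly (f : MvPolynomial (Fin n) ℤ) : MvPolynomial (Fin n) ℝ :=
  MvPolynomial.map (Int.castRingHom ℝ) f

theorem eval_realPoly_intCast (f : MvPolynomial (Fin n) ℤ) (u : Fin n → ℤ) :
    MvPolynomial.eval (fun i => (u i : ℝ)) (realPoly f) = (MvPolynomial.eval u f : ℝ) := by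
  induction f using MvPolynomial.induction_on with
  | C a => simp
  | add p q hp hq => simp only [map_add, hp, hq, Int.cast_add]
  | mul_X p i hp => simp only [map_mul, hp, Int.cast_mul]; simp

theorem toReal_hess (f : MvPolynomial (Fin n) ℤ) (u : Fin n → ℤ) :
    toReal (hess f u) = hess (realPoly f) (fun i => (u i : ℝ)) := by
  ext i j
  change ((hess f u i j : ℤ) : ℝ) = _
  rw [hess_apply, hess_apply, MvPolynomial.pderiv_map, MvPolynomial.pderiv_map,
    eval_realPoly_intCast]

theorem toReal_gridHess (f : MvPolynomial (Fin n) ℤ) :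
    toReal (gridHess f) = ∑ u : Fin n → Fin (f.totalDegree + 1),
      hess (realPoly f) (fun i => (gridPoint u i : ℝ)) := by
  ext i j
  simp only [← toReal_hess, gridHess, Matrix.map_apply, Matrix.sum_apply, Int.cast_sum]

theorem toReal_gridHess_transpose (f : MvPolynomial (Fin n) ℤ) :
    (toReal (gridHess f))ᵀ = toReal (gridHess f) := by
  simp only [toReal_gridHess, Matrix.transpose_sum, hess_transpose]

theorem dotProduct_gridHess (f : MvPolynomial (Fin n) ℤ) (v : Fin n → ℝ) :
    v ⬝ᵥ (toReal (gridHess f) *ᵥ v) = ∑ u : Fin n → Fin (f.totalDegree + 1),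
      v ⬝ᵥ (hess (realPoly f) (fun i => (gridPoint u i : ℝ)) *ᵥ v) := by
  rw [toReal_gridHess, Matrix.sum_mulVec, dotProduct_sum]

/-- The kernel of the summed Hessian of a convex polynomial lies in the kernel of each Hessian. -/
theorem hess_mulVec_eq_zero_of_gridHess (f : MvPolynomial (Fin n) ℤ)
    (hf : ConvexOn ℝ Set.univ fun x : Fin n → ℝ => MvPolynomial.eval x (realPoly f))
    (v : Fin n → ℝ) (hv : toReal (gridHess f) *ᵥ v = 0) (x : Fin n → ℝ) :
    hess (realPoly f) x *ᵥ v = 0 := by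
  have hsum : ∑ u : Fin n → Fin (f.totalDegree + 1),
      v ⬝ᵥ (hess (realPoly f) (fun i => (gridPoint u i : ℝ)) *ᵥ v) = 0 := by
    rw [← dotProduct_gridHess, hv, dotProduct_zero]
  rw [Finset.sum_eq_zero_iff_of_nonneg fun u _ => hess_nonneg _ hf _ _] at hsum
  -- A vanishing sum of nonnegative terms vanishes termwise, and Cauchy–Schwarz turns a zero of the
  -- form into a kernel vector.
  have hgrid : ∀ u : Fin n → Fin (f.totalDegree + 1),
      hess (realPoly f) (fun i => (gridPoint u i : ℝ)) *ᵥ v = 0 := by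
    intro u
    ext i
    have := mulVec_sq_le _ (hess_transpose (realPoly f) fun i => (gridPoint u i : ℝ))
      (hess_nonneg _ hf _) v i
    rw [hsum u (Finset.mem_univ _), mul_zero] at this
    exact pow_eq_zero_iff (two_ne_zero) |>.1 (le_antisymm this (sq_nonneg _))
  ext i
  -- An entry of the Hessian applied to v, as a polynomial in the base point. Its degree in each
  -- variable is at most deg f and it vanishes on a grid with deg f + 1 values per coordinate, so it
  -- is zero.
  set p : MvPolynomial (Fin n) ℝ := ∑ j, MvPolynomial.C (v j) *
    MvPolynomial.pderiv j (MvPolynomial.pderiv i (realPoly f)) with hp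
  have hpe : ∀ y, MvPolynomial.eval y p = (hess (realPoly f) y *ᵥ v) i := by
    intro y
    simp [hp, mulVec, dotProduct, hess_apply, mul_comm]
  have hp0 : p = 0 := by
    refine MvPolynomial.eq_zero_of_eval_zero_at_prod_finset p
      (fun _ => Finset.univ.image fun k : Fin (f.totalDegree + 1) => ((k : ℕ) : ℝ)) ?_ ?_
    · intro k
      rw [Finset.card_image_of_injective _ fun a b hab => Fin.ext (by exact_mod_cast hab),
        Finset.card_univ, Fintype.card_fin, Nat.lt_succ_iff]
      refine (MvPolynomial.degreeOf_le_totalDegree _ _).trans ?_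
      refine (MvPolynomial.totalDegree_finsetSum _ _).trans (Finset.sup_le fun j _ => ?_)
      refine (MvPolynomial.totalDegree_mul _ _).trans ?_
      rw [MvPolynomial.totalDegree_C, zero_add]
      exact ((totalDegree_pderiv_le _ _).trans (totalDegree_pderiv_le _ _)).trans
        (Finset.sup_mono (MvPolynomial.support_map_subset _ _))
    · intro y hy
      simp only [Finset.mem_image, Finset.mem_univ, true_and] at hy
      choose u hu using hy
      have : y = fun i => (gridPoint u i : ℝ) := by
        ext i; simp [gridPoint, hu]
      rw [hpe, this, hgrid u, Pi.zero_apply]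
  rw [← hpe, hp0, map_zero, Pi.zero_apply]

end Hessian

/-! ### Bounding coefficients by interpolation -/

/-- The coefficients solve the Vandermonde system at the nodes 0, …, N, which is integral and
invertible with entries of level 2; `abs_le_of_injective_mulVec` adds five levels. -/
theorem abs_coeff_le {N L : ℕ} (hL : 2 ≤ L) (hN : N + 1 ≤ L) (g : Polynomial ℝ)
    (hg : g.natDegree ≤ N) {c : ℝ} (hc0 : 0 ≤ c)
    (hc : ∀ k : ℕ, k ≤ N → |g.eval (k : ℝ)| ≤ c) (j : ℕ) :
    |g.coeff j| ≤ expBound L 7 * c := by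
  rcases lt_or_ge N j with hj | hj
  · rw [Polynomial.coeff_eq_zero_of_natDegree_lt (hg.trans_lt hj), abs_zero]
    exact mul_nonneg (expBound_pos _ _).le hc0
  let V : Matrix (Fin (N + 1)) (Fin (N + 1)) ℤ := Matrix.vandermonde fun i => ((i : ℕ) : ℤ)
  have hVR : toReal V = Matrix.vandermonde fun i : Fin (N + 1) => ((i : ℕ) : ℝ) := by
    ext i j; simp [V, Matrix.vandermonde_apply]
  have hinj : Function.Injective (toReal V).mulVec := by
    rw [hVR, Matrix.mulVec_injective_iff_isUnit, Matrix.isUnit_iff_isUnit_det, isUnit_iff_ne_zero,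
      Matrix.det_vandermonde_ne_zero_iff]
    exact Nat.cast_injective.comp Fin.val_injective
  refine abs_le_of_injective_mulVec V (a := 2) hL (by norm_num) (by simpa using hN)
    (by simpa using hN) (fun i k => ?_) hinj (fun k : Fin (N + 1) => g.coeff k) (c := c) ?_ hc0
    (⟨j, by omega⟩ : Fin (N + 1))
  · simp only [V, Matrix.vandermonde_apply]
    push_cast
    rw [abs_of_nonneg (by positivity)]
    exact natCast_pow_le_expBound (by omega) (by omega)
  · intro i
    have : (toReal V *ᵥ fun k : Fin (N + 1) => g.coeff k) i = g.eval ((i : ℕ) : ℝ) := by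
      rw [hVR, Polynomial.eval_eq_sum_range' (Nat.lt_succ_of_le hg), ← Fin.sum_univ_eq_sum_range
        (fun k => g.coeff k * ((i : ℕ) : ℝ) ^ k)]
      simp [mulVec, dotProduct, Matrix.vandermonde_apply, mul_comm]
    rw [this]
    exact hc _ (by omega)

/-! ### Bounds on values and Hessians -/

section Bounds
variable {n : ℕ}

/-- The sum of the absolute values of the coefficients. -/
noncomputable def coeffNorm (f : MvPolynomial (Fin n) ℝ) : ℝ := ∑ α ∈ f.support, |f.coeff α|

theorem coeffNorm_nonneg (f : MvPolynomial (Fin n) ℝ) : 0 ≤ coeffNorm f :=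
  Finset.sum_nonneg fun _ _ => abs_nonneg _

theorem abs_eval_le (f : MvPolynomial (Fin n) ℝ) {d : ℕ} (hd : f.totalDegree ≤ d) {U : ℝ}
    (hU : 1 ≤ U) (x : Fin n → ℝ) (hx : ∀ i, |x i| ≤ U) :
    |MvPolynomial.eval x f| ≤ coeffNorm f * U ^ d := by
  rw [MvPolynomial.eval_eq, coeffNorm, Finset.sum_mul]
  refine (Finset.abs_sum_le_sum_abs _ _).trans (Finset.sum_le_sum fun α hα => ?_)
  rw [abs_mul, Finset.abs_prod]
  gcongr
  calc ∏ i ∈ α.support, |x i ^ α i| ≤ ∏ i ∈ α.support, U ^ α i :=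
        Finset.prod_le_prod (fun _ _ => abs_nonneg _) fun i _ => by
          rw [abs_pow]; exact pow_le_pow_left₀ (abs_nonneg _) (hx i) _
    _ = U ^ (α.sum fun _ e => e) := Finset.prod_pow_eq_pow_sum _ _ _
    _ ≤ U ^ d := pow_le_pow_right₀ hU ((MvPolynomial.le_totalDegree hα).trans hd)

theorem coeffNorm_pderiv_le (f : MvPolynomial (Fin n) ℝ) {d : ℕ} (hd : f.totalDegree ≤ d)
    (i : Fin n) : coeffNorm (MvPolynomial.pderiv i f) ≤ d * coeffNorm f := by
  have hinj : Function.Injective fun α : Fin n →₀ ℕ => α + Finsupp.single i 1 :=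
    add_left_injective _
  have hmem : ∀ α ∈ (MvPolynomial.pderiv i f).support, α + Finsupp.single i 1 ∈ f.support := by
    intro α hα
    rw [MvPolynomial.mem_support_iff, MvPolynomial.coeff_pderiv] at hα
    exact MvPolynomial.mem_support_iff.2 (left_ne_zero_of_mul hα)
  calc coeffNorm (MvPolynomial.pderiv i f)
      ≤ ∑ α ∈ (MvPolynomial.pderiv i f).support, d * |f.coeff (α + Finsupp.single i 1)| := by
        refine Finset.sum_le_sum fun α hα => ?_
        rw [MvPolynomial.coeff_pderiv, abs_mul, mul_comm]
        gcongr
        have h1 := (MvPolynomial.le_totalDegree (hmem α hα)).trans hd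
        rw [Finsupp.sum_add_index' (fun _ => rfl) (fun _ _ _ => rfl),
          Finsupp.sum_single_index rfl] at h1
        have h2 : α i ≤ α.sum fun _ e => e := by
          by_cases hi : i ∈ α.support
          · exact Finset.single_le_sum (f := fun j => α j) (fun _ _ => Nat.zero_le _) hi
          · rw [Finsupp.notMem_support_iff.1 hi]; exact Nat.zero_le _
        rw [abs_of_nonneg (by positivity)]
        exact_mod_cast (by omega : α i + 1 ≤ d)
    _ = d * ∑ β ∈ (MvPolynomial.pderiv i f).support.map ⟨_, hinj⟩, |f.coeff β| := by
        rw [Finset.sum_map, Finset.mul_sum]; rfl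
    _ ≤ d * coeffNorm f := by
        gcongr
        refine Finset.sum_le_sum_of_subset_of_nonneg (fun β hβ => ?_) fun _ _ _ => abs_nonneg _
        obtain ⟨α, hα, rfl⟩ := Finset.mem_map.1 hβ
        exact hmem α hα

theorem abs_hess_le (f : MvPolynomial (Fin n) ℝ) {d : ℕ} (hd : f.totalDegree ≤ d) {U : ℝ}
    (hU : 1 ≤ U) (x : Fin n → ℝ) (hx : ∀ i, |x i| ≤ U) (i j : Fin n) :
    |hess f x i j| ≤ d * (d * coeffNorm f) * U ^ d := by
  rw [hess_apply]
  have h1 := (totalDegree_pderiv_le f i).trans hd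
  refine (abs_eval_le _ ((totalDegree_pderiv_le _ j).trans h1) hU x hx).trans ?_
  gcongr
  refine (coeffNorm_pderiv_le _ h1 j).trans ?_
  gcongr
  exact coeffNorm_pderiv_le f hd i

/-- A convex polynomial that is bounded at `x` and at some points near the origin has a Hessian
whose quadratic form at `x` is bounded linearly in the norm of `x`. -/
theorem dotProduct_hess_le (f : MvPolynomial (Fin n) ℝ)
    (hf : ConvexOn ℝ Set.univ fun x : Fin n → ℝ => MvPolynomial.eval x f) {L : ℕ} (hL : 2 ≤ L)
    (hd : f.totalDegree + 1 ≤ L) (x u : Fin n → ℝ) {K : ℝ} (hR : 1 ≤ ‖x‖)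
    (h0 : MvPolynomial.eval 0 f ≤ K) (hx : MvPolynomial.eval x f ≤ K)
    (h2u : MvPolynomial.eval ((2 : ℝ) • u) f ≤ K) (hu : |MvPolynomial.eval u f| ≤ K)
    (hux : MvPolynomial.eval (u - ‖x‖⁻¹ • x) f ≤ K) :
    x ⬝ᵥ (hess f u *ᵥ x) ≤ 16 * (L : ℝ) ^ 2 * (expBound L 7 * (K * ‖x‖)) := by
  have hK : 0 ≤ K := (abs_nonneg _).trans hu
  have hLpos : (0 : ℝ) < L := by have : 0 < L := by omega
                                 exact_mod_cast this
  have hconv : ∀ (y z : Fin n → ℝ) (a b : ℝ), 0 ≤ a → 0 ≤ b → a + b = 1 →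
      MvPolynomial.eval (a • y + b • z) f ≤
        a * MvPolynomial.eval y f + b * MvPolynomial.eval z f :=
    fun y z a b ha hb hab => hf.2 (Set.mem_univ y) (Set.mem_univ z) ha hb hab
  -- The scaling makes every node u + k w with k ≤ deg f equal to u + θ x with θ ≤ 1/2.
  set w : Fin n → ℝ := (2 * (L : ℝ))⁻¹ • x with hw
  have hval : ∀ k : ℕ, k ≤ f.totalDegree →
      |(lineRestr f u w).eval (k : ℝ)| ≤ 2 * (K * ‖x‖) := by
    intro k hk
    rw [eval_lineRestr, hw, smul_smul]
    set θ : ℝ := k * (2 * (L : ℝ))⁻¹ with hθ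
    have hkL : (k : ℝ) ≤ L := by exact_mod_cast (by omega : k ≤ L)
    have hθ0 : 0 ≤ θ := by positivity
    have hθ1 : 2 * θ ≤ 1 := by
      rw [hθ, mul_inv]
      have : (k : ℝ) * (L : ℝ)⁻¹ ≤ 1 := by rwa [← div_eq_mul_inv, div_le_one hLpos]
      linarith
    -- The point u + θx is the midpoint of 2u and 2θx, and 2θx lies on the segment from 0 to x.
    have hup : MvPolynomial.eval (u + θ • x) f ≤ K := by
      have e1 := hconv ((2 : ℝ) • u) ((2 * θ) • x) (1 / 2) (1 / 2) (by norm_num) (by norm_num) (by norm_num)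
      have e2 := hconv 0 x (1 - 2 * θ) (2 * θ)
        (by linarith) (by linarith) (by ring)
      simp only [smul_zero, zero_add, smul_smul] at e1 e2
      have e3 : (1 / 2 * 2 : ℝ) • u + (1 / 2 * (2 * θ)) • x = u + θ • x := by
        rw [show (1 / 2 * 2 : ℝ) = 1 by norm_num, show 1 / 2 * (2 * θ) = θ by ring, one_smul]
      rw [e3] at e1
      nlinarith
    -- The point u lies between u + θx and u - x/‖x‖. Since f(u) ≥ -K and f ≤ K at the second
    -- endpoint, f(u + θx) ≥ -K(1 + 2θ‖x‖), which is linear in ‖x‖.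
    have hlow : -(2 * (K * ‖x‖)) ≤ MvPolynomial.eval (u + θ • x) f := by
      have hR0 : 0 < ‖x‖ := by linarith
      have hs : 0 < 1 + θ * ‖x‖ := by positivity
      have e1 := hconv (u + θ • x) (u - ‖x‖⁻¹ • x)
        (1 / (1 + θ * ‖x‖)) (θ * ‖x‖ / (1 + θ * ‖x‖)) (by positivity) (by positivity)
        (by field_simp)
      have e2 : (1 / (1 + θ * ‖x‖)) • (u + θ • x) +
          (θ * ‖x‖ / (1 + θ * ‖x‖)) • (u - ‖x‖⁻¹ • x) = u := by
        ext i
        simp only [Pi.add_apply, Pi.smul_apply, Pi.sub_apply, smul_eq_mul]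
        field_simp
        ring
      rw [e2] at e1
      rw [div_mul_eq_mul_div, div_mul_eq_mul_div, ← add_div, one_mul, le_div_iff₀ hs] at e1
      have e3 := (abs_le.1 hu).1
      have e4 : θ * ‖x‖ * MvPolynomial.eval (u - ‖x‖⁻¹ • x) f ≤ θ * ‖x‖ * K := by gcongr
      have e5 : -K * (1 + θ * ‖x‖) ≤ MvPolynomial.eval u f * (1 + θ * ‖x‖) := by gcongr
      have e6 : 2 * θ * (K * ‖x‖) ≤ 1 * (K * ‖x‖) := by gcongr
      nlinarith [mul_nonneg hK (sub_nonneg.2 hR)]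
    rw [abs_le]
    refine ⟨hlow, hup.trans ?_⟩
    nlinarith [mul_nonneg hK (sub_nonneg.2 hR)]
  have hc := abs_coeff_le hL hd (lineRestr f u w) (natDegree_lineRestr_le f u w)
    (by positivity) hval 2
  have h2 := two_mul_coeff_two_lineRestr f u w
  have hww : x ⬝ᵥ (hess f u *ᵥ x) = (2 * (L : ℝ)) ^ 2 * (w ⬝ᵥ (hess f u *ᵥ w)) := by
    rw [hw, Matrix.mulVec_smul, smul_dotProduct, dotProduct_smul, smul_eq_mul, smul_eq_mul]
    field_simp
  rw [hww, ← h2]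
  calc (2 * (L : ℝ)) ^ 2 * (2 * (lineRestr f u w).coeff 2)
      ≤ (2 * (L : ℝ)) ^ 2 * (2 * (expBound L 7 * (2 * (K * ‖x‖)))) := by
        gcongr; exact (le_abs_self _).trans hc
    _ = _ := by ring

end Bounds

/-! ### Integer data -/

section Integer
variable {m n : ℕ}

/-- The polyhedron of an integer system of inequalities. -/
def intPolyhedron (A : Matrix (Fin m) (Fin n) ℤ) (b : Fin m → ℤ) : Set (Fin n → ℝ) :=
  {x | ∀ i, (toReal A *ᵥ x) i ≤ (b i : ℝ)}

theorem isClosed_intPolyhedron (A : Matrix (Fin m) (Fin n) ℤ) (b : Fin m → ℤ) :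
    IsClosed (intPolyhedron A b) := by
  simp only [intPolyhedron, Set.ofPred_forall]
  exact isClosed_iInter fun i => isClosed_le
    ((continuous_apply i).comp (continuous_const.matrix_mulVec continuous_id)) continuous_const

/-- The linear programming bound with zero objective and no equations. The value of f at this point
explains the threshold `expBound L 9` used below. -/
theorem exists_small_mem_intPolyhedron {L : ℕ} (hL : 2 ≤ L) (hmn : m + n ≤ L)
    (A : Matrix (Fin m) (Fin n) ℤ) (b : Fin m → ℤ)
    (hA : ∀ i j, |(A i j : ℝ)| ≤ expBound L 1) (hb : ∀ i, |(b i : ℝ)| ≤ expBound L 1)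
    (hne : (intPolyhedron A b).Nonempty) :
    ∃ x ∈ intPolyhedron A b, ‖x‖ ≤ expBound L 7 := by
  obtain ⟨v, hv⟩ := hne
  obtain ⟨w, -, hw, -, hwb⟩ := exists_feasible_abs_le A (0 : Matrix (Fin 0) (Fin n) ℤ) hL le_rfl
    (by omega) (by omega) hA (fun i => i.elim0) 0 (fun i => (b i : ℝ)) v
    (Subsingleton.elim _ _) hv ⟨0, by rintro _ ⟨w, -, rfl⟩; simp⟩ (expBound_pos L 1).le hb
  refine ⟨w, hw, (pi_norm_le_iff_of_nonneg (expBound_pos _ _).le).2 fun i => ?_⟩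
  exact (hwb i).trans (expBound_mul_le hL (by norm_num) (by norm_num))

theorem abs_eval_realPoly_le {L : ℕ} (f : MvPolynomial (Fin n) ℤ)
    (hd : f.totalDegree + 1 ≤ L) (hf1 : coeffNorm (realPoly f) ≤ expBound L 2) (hL : 2 ≤ L)
    {k : ℕ} (hk : 1 ≤ k) (x : Fin n → ℝ) (hx : ‖x‖ ≤ expBound L k) :
    |MvPolynomial.eval x (realPoly f)| ≤ expBound L (k + 2) := by
  refine (abs_eval_le (realPoly f) (d := f.totalDegree) (Finset.sup_mono (MvPolynomial.support_map_subset _ _))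
    (one_le_expBound L k) x fun i => (norm_le_pi_norm x i).trans hx).trans ?_
  exact expBound_mul_mono hL (by omega) (by omega) hf1 (expBound_pow_le (by omega))
    (by have := expBound_pos L k; positivity)

theorem abs_gridHess_le {L : ℕ} (f : MvPolynomial (Fin n) ℤ)
    (hd : f.totalDegree + 1 ≤ L) (hn : n ≤ L) (hf1 : coeffNorm (realPoly f) ≤ expBound L 2)
    (hL : 2 ≤ L) (i j : Fin n) : |(gridHess f i j : ℝ)| ≤ expBound L 6 := by
  have h1 : (gridHess f i j : ℝ) = ∑ u : Fin n → Fin (f.totalDegree + 1),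
      hess (realPoly f) (fun i => (gridPoint u i : ℝ)) i j := by
    rw [← Matrix.sum_apply, ← toReal_gridHess]; rfl
  have hcn := coeffNorm_nonneg (realPoly f)
  rw [h1]
  refine (abs_sum_le_card_mul (c := expBound L 5) _ fun u => ?_).trans ?_
  · refine (abs_hess_le (realPoly f) (d := f.totalDegree) (U := expBound L 1)
      (Finset.sup_mono (MvPolynomial.support_map_subset _ _))
      (one_le_expBound L 1) _ (fun k => ?_) i j).trans ?_
    · simp only [gridPoint, Int.cast_natCast, Nat.abs_cast]
      exact natCast_le_expBound (by omega)
    · refine expBound_mul_mono (a := 4) (b := 2) hL (by norm_num) (by norm_num) ?_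
        (expBound_pow_le (by omega)) (by have := expBound_pos L 1; positivity)
      refine expBound_mul_mono (a := 1) (b := 3) hL (by norm_num) (by norm_num)
        (natCast_le_expBound (by omega)) ?_ (by positivity)
      exact expBound_mul_mono (a := 1) (b := 2) hL (by norm_num) (by norm_num)
        (natCast_le_expBound (by omega)) hf1 hcn
  · refine expBound_mul_mono (a := 2) (b := 5) hL (by norm_num) (by norm_num) ?_ le_rfl
      (expBound_pos _ _).le
    simp only [Fintype.card_pi, Fintype.card_fin, Finset.prod_const, Finset.card_univ]
    push_cast
    exact_mod_cast natCast_pow_le_expBound hd hn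

/-- For a grid point u, the points u, 2u and u - x/‖x‖ lie in a ball where |f| is small, so each
Hessian contributes O(‖x‖); there are at most L ^ L grid points. -/
theorem dotProduct_gridHess_le {L : ℕ} (f : MvPolynomial (Fin n) ℤ)
    (hf : ConvexOn ℝ Set.univ fun x : Fin n → ℝ => MvPolynomial.eval x (realPoly f))
    (hd : f.totalDegree + 1 ≤ L) (hn : n ≤ L) (hf1 : coeffNorm (realPoly f) ≤ expBound L 2)
    (hL : 2 ≤ L) (x : Fin n → ℝ) (hR : 1 ≤ ‖x‖)
    (hx : MvPolynomial.eval x (realPoly f) ≤ expBound L 9) :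
    x ⬝ᵥ (toReal (gridHess f) *ᵥ x) ≤ expBound L 12 * ‖x‖ := by
  have hE : ∀ k, 0 < expBound L k := expBound_pos L
  have hdeg : (realPoly f).totalDegree ≤ f.totalDegree :=
    Finset.sup_mono (MvPolynomial.support_map_subset _ _)
  have hsmall : ∀ y : Fin n → ℝ, ‖y‖ ≤ expBound L 2 →
      |MvPolynomial.eval y (realPoly f)| ≤ expBound L 9 := fun y hy =>
    (abs_eval_realPoly_le f hd hf1 hL (by norm_num) y hy).trans (expBound_mono hL (by norm_num))
  have hL16 : 16 * (L : ℝ) ^ 2 ≤ expBound L 3 := by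
    refine expBound_mul_mono (a := 2) (b := 2) hL (by norm_num) (by norm_num) ?_
      (natCast_pow_le_expBound le_rfl hL) (by positivity)
    calc (16 : ℝ) = 2 ^ 2 ^ 2 := by norm_num
      _ ≤ expBound L 2 := pow_le_pow_right₀ (by norm_num) (Nat.pow_le_pow_left hL 2)
  have hpt : ∀ u : Fin n → Fin (f.totalDegree + 1),
      x ⬝ᵥ (hess (realPoly f) (fun i => (gridPoint u i : ℝ)) *ᵥ x) ≤ expBound L 11 * ‖x‖ := by
    intro u
    set y : Fin n → ℝ := fun i => (gridPoint u i : ℝ) with hy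
    have hy1 : ‖y‖ ≤ f.totalDegree := by
      refine (pi_norm_le_iff_of_nonneg (by positivity)).2 fun i => ?_
      simp only [hy, gridPoint, Int.cast_natCast, Real.norm_natCast]
      exact_mod_cast Nat.lt_succ_iff.1 (u i).2
    have hyE : ‖y‖ + 1 ≤ expBound L 1 := by
      refine le_trans ?_ (natCast_le_expBound hd)
      push_cast; linarith
    refine (dotProduct_hess_le (realPoly f) hf (K := expBound L 9) hL (by omega) x y hR
      ((le_abs_self _).trans (hsmall 0 (by simpa using (hE 2).le))) hx
      ((le_abs_self _).trans (hsmall _ ?_)) (hsmall _ ?_)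
      ((le_abs_self _).trans (hsmall _ ?_))).trans ?_
    · rw [norm_smul, Real.norm_ofNat]
      exact expBound_mul_mono (a := 0) (b := 1) hL (by norm_num) (by norm_num)
        (two_le_expBound hL 0) (by linarith) (norm_nonneg _)
    · exact (by linarith : ‖y‖ ≤ expBound L 1).trans (expBound_mono hL (by norm_num))
    · refine (norm_sub_le _ _).trans ?_
      rw [norm_smul, norm_inv, norm_norm, inv_mul_cancel₀ (by linarith)]
      exact hyE.trans (expBound_mono hL (by norm_num))
    · rw [← mul_assoc, ← mul_assoc]
      gcongr
      rw [mul_assoc]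
      exact expBound_mul_mono (a := 3) (b := 10) hL (by norm_num) (by norm_num) hL16
        (expBound_mul_le hL (by norm_num) (by norm_num)) (mul_pos (hE _) (hE _)).le
  rw [dotProduct_gridHess]
  refine (Finset.sum_le_card_nsmul _ _ _ fun u _ => hpt u).trans ?_
  rw [nsmul_eq_mul, ← mul_assoc]
  gcongr
  refine expBound_mul_mono (a := 2) (b := 11) hL (by norm_num) (by norm_num) ?_ le_rfl (hE _).le
  simp only [Finset.card_univ, Fintype.card_pi, Fintype.card_fin, Finset.prod_const]
  exact_mod_cast natCast_pow_le_expBound hd hn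

/-- A feasible point of large norm can be replaced by one of smaller norm without increasing the
objective. -/
theorem exists_sq_norm_le {L : ℕ} (f : MvPolynomial (Fin n) ℤ) (A : Matrix (Fin m) (Fin n) ℤ)
    (b : Fin m → ℤ)
    (hf : ConvexOn ℝ Set.univ fun x : Fin n → ℝ => MvPolynomial.eval x (realPoly f))
    (hd : f.totalDegree + 1 ≤ L) (hmn : m + n ≤ L) (hf1 : coeffNorm (realPoly f) ≤ expBound L 2)
    (hL : 2 ≤ L) (hA : ∀ i j, |(A i j : ℝ)| ≤ expBound L 1)
    (hb : ∀ i, |(b i : ℝ)| ≤ expBound L 1)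
    (hbdd : BddBelow ((fun x => MvPolynomial.eval x (realPoly f)) '' intPolyhedron A b))
    (x : Fin n → ℝ) (hxP : x ∈ intPolyhedron A b) (hR : 1 ≤ ‖x‖)
    (hx : MvPolynomial.eval x (realPoly f) ≤ expBound L 9) :
    ∃ z ∈ intPolyhedron A b, MvPolynomial.eval z (realPoly f) ≤ MvPolynomial.eval x (realPoly f) ∧
      ‖z‖ ^ 2 ≤ expBound L 17 * ‖x‖ := by
  have hE : ∀ k, 0 < expBound L k := expBound_pos L
  have hn : n ≤ L := by omega
  set M := gridHess f with hM
  have hMb : ∀ i j, |(M i j : ℝ)| ≤ expBound L 6 := abs_gridHess_le f hd hn hf1 hL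
  have hpsd : ∀ v, 0 ≤ v ⬝ᵥ (toReal M *ᵥ v) := fun v => by
    rw [dotProduct_gridHess]
    exact Finset.sum_nonneg fun u _ => hess_nonneg _ hf _ _
  -- By Cauchy–Schwarz (Mx)ᵢ² ≤ Mᵢᵢ · xᵀMx, with factors of levels 6 and 12. The gain over ‖x‖ is
  -- this square root.
  set c : ℝ := √(expBound L 13 * ‖x‖) with hc
  have hc2 : c ^ 2 = expBound L 13 * ‖x‖ := Real.sq_sqrt (by have := hE 13; positivity)
  have hc1 : 1 ≤ c := Real.one_le_sqrt.2 (by nlinarith [one_le_expBound L 13])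
  have hMx : ∀ i, |(toReal M *ᵥ x) i| ≤ c := by
    intro i
    refine Real.abs_le_sqrt ((mulVec_sq_le _ (toReal_gridHess_transpose f) hpsd x i).trans ?_)
    calc toReal M i i * (x ⬝ᵥ (toReal M *ᵥ x))
        ≤ expBound L 6 * (expBound L 12 * ‖x‖) := by
          refine mul_le_mul ((le_abs_self _).trans (hMb i i)) ?_ (hpsd x) (hE 6).le
          exact dotProduct_gridHess_le f hf hd hn hf1 hL x hR hx
      _ ≤ _ := by
          rw [← mul_assoc]; gcongr; exact expBound_mul_le hL (by norm_num) (by norm_num)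
  obtain ⟨s, hs, hsb⟩ := exists_mulVec_eq_abs_le M hL (by norm_num) (by simpa using hn)
    (by simpa using hn) hMb x hMx (by linarith)
  have hlin : ∀ v, toReal M *ᵥ v = 0 → MvPolynomial.eval (s + v) (realPoly f) =
      MvPolynomial.eval s (realPoly f) +
        ∑ i, v i * MvPolynomial.eval s (MvPolynomial.pderiv i (realPoly f)) := fun v hv =>
    eval_add_of_hess_mulVec_eq_zero _ v (hess_mulVec_eq_zero_of_gridHess f hf v hv) s
  set ℓ : (Fin n → ℝ) →ₗ[ℝ] ℝ := ∑ i,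
    MvPolynomial.eval s (MvPolynomial.pderiv i (realPoly f)) • LinearMap.proj i with hℓ
  have hℓe : ∀ v, ℓ v = ∑ i, v i * MvPolynomial.eval s (MvPolynomial.pderiv i (realPoly f)) := by
    intro v; simp [hℓ, mul_comm]
  have hfeas : ∀ v, (∀ i, (toReal A *ᵥ v) i ≤ b i - (toReal A *ᵥ s) i) →
      s + v ∈ intPolyhedron A b := by
    intro v hv i
    rw [Matrix.mulVec_add, Pi.add_apply]
    linarith [hv i]
  have hCb : ∀ i, |(b i : ℝ) - (toReal A *ᵥ s) i| ≤ expBound L 13 * c := by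
    intro i
    have h1 : |(toReal A *ᵥ s) i| ≤ expBound L 12 * c := by
      refine (abs_sum_le_card_mul (ι := Fin n) (c := expBound L 1 * (expBound L 11 * c)) _ fun j => ?_).trans ?_
      · rw [abs_mul]
        exact mul_le_mul (hA i j) (hsb j) (abs_nonneg _) (hE 1).le
      · rw [← mul_assoc, ← mul_assoc, Fintype.card_fin]
        gcongr
        refine expBound_mul_mono (a := 2) (b := 11) hL (by norm_num) (by norm_num) ?_ le_rfl
          (hE _).le
        exact expBound_mul_mono (a := 1) (b := 1) hL (by norm_num) (by norm_num)
          (natCast_le_expBound hn) le_rfl (hE 1).le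
    have h2 : expBound L 1 + expBound L 12 ≤ expBound L 13 :=
      expBound_add_mono hL (by norm_num) (by norm_num) le_rfl le_rfl
    calc |(b i : ℝ) - (toReal A *ᵥ s) i| ≤ |(b i : ℝ)| + |(toReal A *ᵥ s) i| := abs_sub _ _
      _ ≤ expBound L 1 * c + expBound L 12 * c :=
          add_le_add ((hb i).trans (le_mul_of_one_le_right (hE 1).le hc1)) h1
      _ ≤ _ := by rw [← add_mul]; gcongr
  -- Linear program in v ∈ ker M with s + v ∈ P; v = x - s is feasible, and the objective is bounded
  -- below because f is bounded below on P.
  obtain ⟨w, hwM, hwA, hwl, hwb⟩ := exists_feasible_abs_le A M (a := 6) hL (by norm_num) hmn hn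
    (fun i j => (hA i j).trans (expBound_mono hL (by norm_num))) hMb ℓ
    (fun i => b i - (toReal A *ᵥ s) i) (x - s)
    (by rw [Matrix.mulVec_sub, hs, sub_self])
    (fun i => by rw [Matrix.mulVec_sub, Pi.sub_apply]; linarith [hxP i])
    (by
      obtain ⟨K, hK⟩ := hbdd
      refine ⟨K - MvPolynomial.eval s (realPoly f), ?_⟩
      rintro _ ⟨v, ⟨hv, hvA⟩, rfl⟩
      have := hK ⟨s + v, hfeas v hvA, rfl⟩
      simp only [hlin v hv, ← hℓe] at this
      linarith)
    (by have := hE 13; positivity) hCb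
  refine ⟨s + w, hfeas w hwA, ?_, ?_⟩
  · have h1 := hlin (x - s) (by rw [Matrix.mulVec_sub, hs, sub_self])
    rw [add_sub_cancel] at h1
    rw [hlin w hwM, h1, ← hℓe, ← hℓe]
    linarith
  · have hz : ‖s + w‖ ≤ expBound L 15 * c := by
      refine (pi_norm_le_iff_of_nonneg (by have := hE 15; positivity)).2 fun i => ?_
      refine (abs_add_le _ _).trans ?_
      refine (add_le_add (hsb i) (hwb i)).trans ?_
      rw [← mul_assoc, ← add_mul]
      gcongr
      exact expBound_add_mono (a := 11) (b := 14) hL (by norm_num) (by norm_num) le_rfl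
        (expBound_mul_le hL (by norm_num) (by norm_num))
    calc ‖s + w‖ ^ 2 ≤ (expBound L 15 * c) ^ 2 := by gcongr
      _ = expBound L 15 * expBound L 15 * expBound L 13 * ‖x‖ := by rw [mul_pow, hc2]; ring
      _ ≤ _ := by
        gcongr
        exact expBound_mul_mono (a := 16) (b := 13) hL (by norm_num) (by norm_num)
          (expBound_mul_le hL (by norm_num) (by norm_num)) le_rfl (hE _).le

/-- A convex integer polynomial bounded below on an integer polyhedron has a minimizer of bounded
norm. -/
theorem exists_isMinOn_norm_le {L : ℕ} (f : MvPolynomial (Fin n) ℤ)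
    (A : Matrix (Fin m) (Fin n) ℤ) (b : Fin m → ℤ)
    (hf : ConvexOn ℝ Set.univ fun x : Fin n → ℝ => MvPolynomial.eval x (realPoly f))
    (hd : f.totalDegree + 1 ≤ L) (hmn : m + n ≤ L) (hf1 : coeffNorm (realPoly f) ≤ expBound L 2)
    (hL : 2 ≤ L) (hA : ∀ i j, |(A i j : ℝ)| ≤ expBound L 1)
    (hb : ∀ i, |(b i : ℝ)| ≤ expBound L 1) (hne : (intPolyhedron A b).Nonempty)
    (hbdd : BddBelow ((fun x => MvPolynomial.eval x (realPoly f)) '' intPolyhedron A b)) :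
    ∃ x ∈ intPolyhedron A b,
      IsMinOn (fun x => MvPolynomial.eval x (realPoly f)) (intPolyhedron A b) x ∧
      ‖x‖ ≤ expBound L 17 := by
  have hcont : Continuous fun x : Fin n → ℝ => MvPolynomial.eval x (realPoly f) :=
    MvPolynomial.continuous_eval _
  have hclosed := isClosed_intPolyhedron A b
  obtain ⟨x₀, hx₀P, hx₀⟩ := exists_small_mem_intPolyhedron hL hmn A b hA hb hne
  have hx₀f : MvPolynomial.eval x₀ (realPoly f) ≤ expBound L 9 :=
    (le_abs_self _).trans (abs_eval_realPoly_le f hd hf1 hL (by norm_num) x₀ hx₀)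
  have hx₀' : ‖x₀‖ ≤ expBound L 17 := hx₀.trans (expBound_mono hL (by norm_num))
  have hred : ∀ y ∈ intPolyhedron A b, ∃ z ∈ intPolyhedron A b,
      MvPolynomial.eval z (realPoly f) ≤ MvPolynomial.eval y (realPoly f) ∧
        ‖z‖ ≤ expBound L 17 := by
    intro y hy
    rcases le_total (MvPolynomial.eval x₀ (realPoly f)) (MvPolynomial.eval y (realPoly f)) with h | h
    · exact ⟨x₀, hx₀P, h, hx₀'⟩
    -- Cutting with the ball of radius ‖y‖ gives compactness and loses no candidate for the point of
    -- least norm in the sublevel set.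
    have hcomp : IsCompact ((intPolyhedron A b ∩
        {z | MvPolynomial.eval z (realPoly f) ≤ MvPolynomial.eval y (realPoly f)}) ∩
          Metric.closedBall 0 ‖y‖) :=
      (isCompact_closedBall _ _).inter_left
        (hclosed.inter (isClosed_le hcont continuous_const))
    obtain ⟨z, ⟨⟨hzP, hzf⟩, hzy⟩, hzmin⟩ := hcomp.exists_isMinOn
      ⟨y, ⟨hy, by simp⟩, by simp⟩ continuous_norm.continuousOn
    refine ⟨z, hzP, hzf, ?_⟩
    by_contra! hlt
    have hz1 : 1 ≤ ‖z‖ := (one_le_expBound L 17).trans hlt.le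
    obtain ⟨w, hwP, hwf, hwn⟩ := exists_sq_norm_le f A b hf hd hmn hf1 hL hA hb hbdd z hzP hz1
      ((le_trans hzf h).trans hx₀f)
    -- Here ‖w‖² ≤ `expBound L 17` · ‖z‖ < ‖z‖², which contradicts the minimality of ‖z‖.
    have hwz : ‖w‖ < ‖z‖ := by
      by_contra! hle
      nlinarith
    rw [mem_closedBall_zero_iff] at hzy
    have := hzmin ⟨⟨hwP, hwf.trans hzf⟩, mem_closedBall_zero_iff.2 (hwz.le.trans hzy)⟩
    exact absurd this (not_le.2 hwz)
  obtain ⟨x, ⟨hxP, hxn⟩, hxmin⟩ := ((isCompact_closedBall (0 : Fin n → ℝ)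
    (expBound L 17)).inter_left hclosed).exists_isMinOn
      ⟨x₀, hx₀P, mem_closedBall_zero_iff.2 hx₀'⟩ hcont.continuousOn
  refine ⟨x, hxP, fun y hy => ?_, mem_closedBall_zero_iff.1 hxn⟩
  obtain ⟨z, hzP, hzf, hzn⟩ := hred y hy
  exact le_trans (hxmin ⟨hzP, mem_closedBall_zero_iff.2 hzn⟩) hzf

end Integer

theorem log_le_of_le_expBound {L k : ℕ} {x : ℝ} (hx0 : 0 ≤ x) (hx : x ≤ expBound L k) :
    Real.log x ≤ ((L ^ k : ℕ) : ℝ) := by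
  rcases hx0.eq_or_lt with rfl | h0
  -- The value `Real.log 0 = 0` realises the convention for a minimiser at the origin.
  · rw [Real.log_zero]; positivity
  calc Real.log x ≤ Real.log (expBound L k) := Real.log_le_log h0 hx
    _ = ((L ^ k : ℕ) : ℝ) * Real.log 2 := by rw [expBound, Real.log_pow]
    _ ≤ ((L ^ k : ℕ) : ℝ) * 1 := by
        gcongr
        linarith [Real.log_two_lt_d9]
    _ = _ := mul_one _

/-! ### Clearing denominators -/

theorem natAbs_le_two_pow_intBitLength (k : ℤ) : k.natAbs ≤ 2 ^ intBitLength k :=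
  (Nat.le_pow_clog (by norm_num) _).trans
    (Nat.pow_le_pow_right (by norm_num) (le_max_right _ _))

theorem one_le_ratBitLength (r : ℚ) : 1 ≤ ratBitLength r :=
  (le_max_left 1 _).trans (Nat.le_add_right _ _)

/-- A finite family of rationals has a common denominator for which the numerators are bounded by
two to the total bit length. -/
theorem exists_common_denominator {ι : Type*} (s : Finset ι) (q : ι → ℚ) :
    ∃ (D : ℕ) (k : ι → ℤ), 0 < D ∧
      ∀ i ∈ s, (k i : ℚ) = D * q i ∧ |k i| ≤ 2 ^ ∑ j ∈ s, ratBitLength (q j) := by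
  -- The numerator of D · qᵢ uses the bits of one numerator and at most those of all denominators,
  -- which together fit into the total bit length.
  set D := ∏ j ∈ s, (q j).den with hD
  have hDb : D ≤ 2 ^ ∑ j ∈ s, intBitLength ((q j).den : ℤ) := by
    rw [hD, ← Finset.prod_pow_eq_pow_sum]
    exact Finset.prod_le_prod' fun j _ => natAbs_le_two_pow_intBitLength ((q j).den : ℤ)
  refine ⟨D, fun i => (q i).num * ((D / (q i).den : ℕ) : ℤ),
    Finset.prod_pos fun j _ => (q j).den_pos, fun i hi => ⟨?_, ?_⟩⟩
  · have hdvd : (q i).den ∣ D := Finset.dvd_prod_of_mem _ hi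
    have hne : ((q i).den : ℚ) ≠ 0 := by exact_mod_cast (q i).den_ne_zero
    rw [Int.cast_mul, Int.cast_natCast, Nat.cast_div hdvd hne]
    calc ((q i).num : ℚ) * (D / (q i).den) = D * ((q i).num / (q i).den) := by ring
      _ = D * q i := by rw [Rat.num_div_den]
  · rw [abs_mul, Nat.abs_cast]
    have h1 : ((q i).num.natAbs * (D / (q i).den)) ≤ 2 ^ ∑ j ∈ s, ratBitLength (q j) := by
      calc (q i).num.natAbs * (D / (q i).den)
          ≤ 2 ^ intBitLength (q i).num * 2 ^ ∑ j ∈ s, intBitLength ((q j).den : ℤ) :=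
            Nat.mul_le_mul (natAbs_le_two_pow_intBitLength _) ((Nat.div_le_self _ _).trans hDb)
        _ ≤ _ := by
            rw [← pow_add]
            refine Nat.pow_le_pow_right (by norm_num) ?_
            simp only [ratBitLength, Finset.sum_add_distrib]
            gcongr
            exact Finset.single_le_sum (f := fun j => intBitLength (q j).num)
              (fun _ _ => Nat.zero_le _) hi
    rw [Int.abs_eq_natAbs]
    exact_mod_cast h1

/-- A positive multiple of a rational polynomial with integer coefficients of bounded size. -/
theorem exists_integer_polynomial {n : ℕ} (f : MvPolynomial (Fin n) ℚ) {L : ℕ}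
    (hL : polynomialEncLength f ≤ L) (hL2 : 2 ≤ L) :
    ∃ (D : ℕ) (g : MvPolynomial (Fin n) ℤ), 0 < D ∧ g.totalDegree ≤ f.totalDegree ∧
      coeffNorm (realPoly g) ≤ expBound L 2 ∧
      ∀ x : EuclideanSpace ℝ (Fin n),
        MvPolynomial.eval (fun i => x i) (realPoly g) = D * realFun f x := by
  classical
  obtain ⟨D, k, hD, hk⟩ := exists_common_denominator f.support fun α => f.coeff α
  have hbits : ∑ α ∈ f.support, ratBitLength (f.coeff α) ≤ L :=
    (Nat.le_add_left _ _).trans hL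
  have hcard : f.support.card ≤ L := by
    refine le_trans ?_ hbits
    rw [Finset.card_eq_sum_ones]
    exact Finset.sum_le_sum fun α _ => one_le_ratBitLength _
  set g : MvPolynomial (Fin n) ℤ := ∑ α ∈ f.support, MvPolynomial.monomial α (k α) with hg
  have hcoeff : ∀ α, g.coeff α = if α ∈ f.support then k α else 0 := by
    intro α
    rw [hg, MvPolynomial.coeff_sum]
    simp [MvPolynomial.coeff_monomial]
  refine ⟨D, g, hD, ?_, ?_, fun x => ?_⟩
  · refine (MvPolynomial.totalDegree_finsetSum _ _).trans (Finset.sup_le fun α hα => ?_)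
    exact (MvPolynomial.totalDegree_monomial_le _ _).trans (MvPolynomial.le_totalDegree hα)
  · have hsub : (realPoly g).support ⊆ f.support := by
      intro α hα
      by_contra hn
      rw [MvPolynomial.mem_support_iff, MvPolynomial.coeff_map, hcoeff, if_neg hn] at hα
      simp at hα
    calc coeffNorm (realPoly g) ≤ ∑ α ∈ f.support, |(realPoly g).coeff α| :=
          Finset.sum_le_sum_of_subset_of_nonneg hsub fun _ _ _ => abs_nonneg _
      _ ≤ ∑ α ∈ f.support, expBound L 1 := Finset.sum_le_sum fun α hα => by
          rw [MvPolynomial.coeff_map, hcoeff, if_pos hα, eq_intCast]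
          have h1 : |(k α : ℝ)| ≤ 2 ^ ∑ α ∈ f.support, ratBitLength (f.coeff α) := by
            exact_mod_cast (hk α hα).2
          refine h1.trans ?_
          rw [expBound, pow_one]
          exact pow_le_pow_right₀ (by norm_num) hbits
      _ = f.support.card * expBound L 1 := by rw [Finset.sum_const, nsmul_eq_mul]
      _ ≤ _ := expBound_mul_mono (a := 1) (b := 1) hL2 (by norm_num) (by norm_num)
          (natCast_le_expBound hcard) le_rfl (expBound_pos _ _).le
  · rw [realFun]
    conv_rhs => rw [← MvPolynomial.support_sum_monomial_coeff f]
    simp only [hg, map_sum, Finset.mul_sum]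
    refine Finset.sum_congr rfl fun α hα => ?_
    have h1 : (k α : ℝ) = D * ((f.coeff α : ℚ) : ℝ) := by exact_mod_cast (hk α hα).1
    rw [MvPolynomial.map_monomial, MvPolynomial.eval_monomial, MvPolynomial.aeval_monomial,
      eq_intCast, h1, eq_ratCast, mul_assoc]

/-- A rational polyhedron is an integer polyhedron with data of bounded size. -/
theorem exists_integer_polyhedron {m n : ℕ} (A : Matrix (Fin m) (Fin n) ℚ) (b : Fin m → ℚ)
    {L : ℕ} (hL : polyhedronEncLength A b ≤ L) :
    ∃ (A' : Matrix (Fin m) (Fin n) ℤ) (b' : Fin m → ℤ),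
      (∀ i j, |(A' i j : ℝ)| ≤ expBound L 1) ∧ (∀ i, |(b' i : ℝ)| ≤ expBound L 1) ∧
      ∀ x : EuclideanSpace ℝ (Fin n),
        (fun i => x i) ∈ intPolyhedron A' b' ↔ x ∈ polyhedron A b := by
  obtain ⟨D, k, hD, hk⟩ := exists_common_denominator
    (Finset.univ : Finset ((Fin m × Fin n) ⊕ Fin m)) (Sum.elim (fun p => A p.1 p.2) b)
  have hbits : ∑ j : (Fin m × Fin n) ⊕ Fin m,
      ratBitLength (Sum.elim (fun p => A p.1 p.2) b j) ≤ L := by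
    refine le_trans (le_of_eq ?_) hL
    rw [Fintype.sum_sum_type, Fintype.sum_prod_type]
    rfl
  have hkb : ∀ j, |(k j : ℝ)| ≤ expBound L 1 := by
    intro j
    have h1 : |(k j : ℝ)| ≤ 2 ^ ∑ j : (Fin m × Fin n) ⊕ Fin m,
        ratBitLength (Sum.elim (fun p => A p.1 p.2) b j) := by
      exact_mod_cast (hk j (Finset.mem_univ j)).2
    refine h1.trans ?_
    rw [expBound, pow_one]
    exact pow_le_pow_right₀ (by norm_num) hbits
  refine ⟨Matrix.of fun i j => k (Sum.inl (i, j)), fun i => k (Sum.inr i),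
    fun i j => hkb _, fun i => hkb _, fun x => ?_⟩
  have hA : ∀ i j, (k (Sum.inl (i, j)) : ℝ) = D * (A i j : ℝ) := fun i j => by
    exact_mod_cast (hk (Sum.inl (i, j)) (Finset.mem_univ _)).1
  have hb : ∀ i, (k (Sum.inr i) : ℝ) = D * (b i : ℝ) := fun i => by
    exact_mod_cast (hk (Sum.inr i) (Finset.mem_univ _)).1
  have hD' : (0 : ℝ) < D := by exact_mod_cast hD
  refine forall_congr' fun i => ?_
  have h1 : (toReal (Matrix.of fun i j => k (Sum.inl (i, j))) *ᵥ fun i => x i) i =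
      D * ∑ j, (A i j : ℝ) * x j := by
    change ∑ j, (k (Sum.inl (i, j)) : ℝ) * x j = _
    simp only [hA, mul_assoc, Finset.mul_sum]
  rw [h1, hb]
  exact mul_le_mul_iff_right₀ hD'

end ConvexPolyProg

/-! ### The main theorem -/

theorem theorem1p1 :
    ∃ p : MvPolynomial (Fin 2) ℕ,
      ∀ (n m : ℕ) (f : MvPolynomial (Fin n) ℚ) (A : Matrix (Fin m) (Fin n) ℚ) (b : Fin m → ℚ),
        ConvexOn ℝ Set.univ (ConvexPolyProg.realFun f) →
        (ConvexPolyProg.polyhedron A b).Nonempty →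
        ¬ BddBelow (ConvexPolyProg.realFun f '' ConvexPolyProg.polyhedron A b) ∨
        ∃ x ∈ ConvexPolyProg.polyhedron A b,
          IsMinOn (ConvexPolyProg.realFun f) (ConvexPolyProg.polyhedron A b) x ∧
          Real.log ‖x‖ ≤
            ((MvPolynomial.eval
              ![ConvexPolyProg.polynomialEncLength f, ConvexPolyProg.polyhedronEncLength A b]
              p : ℕ) : ℝ) := by
  open ConvexPolyProg in
  -- The base is L; the summand 2 ensures L ≥ 2 and deg f + 1 ≤ L even for trivial data. Level 17
  -- bounds the sup norm, and two more levels absorb the passage to the Euclidean norm.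
  refine ⟨(MvPolynomial.X 0 + MvPolynomial.X 1 + MvPolynomial.C 2) ^ 19,
    fun n m f A b hf hne => or_iff_not_imp_left.2 fun hbdd => ?_⟩
  rw [not_not] at hbdd
  obtain ⟨L, hL⟩ : ∃ L, L = polynomialEncLength f + polyhedronEncLength A b + 2 := ⟨_, rfl⟩
  have hL2 : 2 ≤ L := by omega
  have hnd : n + f.totalDegree ≤ polynomialEncLength f := Nat.le_add_right _ _
  -- Each entry of b has positive bit length, so the encoding length also bounds the number of
  -- constraints.
  have hm : m ≤ polyhedronEncLength A b := by
    calc m = ∑ _i : Fin m, 1 := by simp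
      _ ≤ vecBitLength b := Finset.sum_le_sum fun i _ => one_le_ratBitLength _
      _ ≤ _ := Nat.le_add_left _ _
  obtain ⟨D, g, hD, hgdeg, hg1, hge⟩ := exists_integer_polynomial f (L := L) (by omega) hL2
  obtain ⟨A', b', hA', hb', hP⟩ := exists_integer_polyhedron A b (L := L) (by omega)
  have hD' : (0 : ℝ) < D := by exact_mod_cast hD
  have hge' : ∀ x : Fin n → ℝ,
      MvPolynomial.eval x (realPoly g) = D * realFun f (WithLp.toLp 2 x) := fun x => hge _
  have hP' : ∀ x : Fin n → ℝ, x ∈ intPolyhedron A' b' ↔ WithLp.toLp 2 x ∈ polyhedron A b :=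
    fun x => hP _
  have hconv : ConvexOn ℝ Set.univ fun x : Fin n → ℝ => MvPolynomial.eval x (realPoly g) := by
    simp only [hge']
    exact (hf.comp_linearMap (WithLp.linearEquiv 2 ℝ (Fin n → ℝ)).symm.toLinearMap).smul hD'.le
  obtain ⟨x, hxP, hxmin, hxn⟩ := exists_isMinOn_norm_le g A' b' hconv (by omega) (by omega)
    hg1 hL2 hA' hb' (by obtain ⟨x, hx⟩ := hne; exact ⟨_, (hP x).2 hx⟩) (by
      obtain ⟨K, hK⟩ := hbdd
      refine ⟨D * K, ?_⟩
      rintro _ ⟨y, hy, rfl⟩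
      simp only [hge']
      exact mul_le_mul_of_nonneg_left (hK ⟨_, (hP' y).1 hy, rfl⟩) hD'.le)
  refine ⟨WithLp.toLp 2 x, (hP' x).1 hxP, fun y hy => ?_, ?_⟩
  · have h : MvPolynomial.eval x (realPoly g) ≤ MvPolynomial.eval (fun i => y i) (realPoly g) :=
      hxmin ((hP y).2 hy)
    rw [hge', hge] at h
    exact le_of_mul_le_mul_left h hD'
  · have hnorm : ‖WithLp.toLp 2 x‖ ≤ expBound L 19 := by
      rw [EuclideanSpace.norm_eq, Real.sqrt_le_left (expBound_pos _ _).le]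
      calc ∑ i, ‖x i‖ ^ 2 ≤ ∑ _i : Fin n, expBound L 17 ^ 2 := Finset.sum_le_sum fun i _ => by
            gcongr; exact (norm_le_pi_norm x i).trans hxn
        _ = n * expBound L 17 ^ 2 := by simp
        _ ≤ expBound L 19 := expBound_mul_mono (a := 1) (b := 18) hL2 (by norm_num) (by norm_num)
            (natCast_le_expBound (by omega)) (expBound_pow_le hL2) (by positivity)
        _ ≤ expBound L 19 ^ 2 := le_self_pow₀ (one_le_expBound _ _) two_ne_zero
    have hp : MvPolynomial.eval ![polynomialEncLength f, polyhedronEncLength A b]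
        ((MvPolynomial.X 0 + MvPolynomial.X 1 + MvPolynomial.C 2) ^ 19) = L ^ 19 := by
      rw [map_pow, map_add, map_add, MvPolynomial.eval_X, MvPolynomial.eval_X,
        MvPolynomial.eval_C, hL]
      rfl
    rw [hp]
    exact log_le_of_le_expBound (norm_nonneg _) hnorm
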